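/- Let $R$ be a commutative Noetherian local ring which is Gorenstein, i.e. of finite injective dimension as a module over itself. All modules are finitely generated. $\mathrm{MCM}(R)$ is the category of maximal Cohen–Macaulay modules (depth at least $\dim R$, with $\operatorname{depth} 0=\infty$), and $\underline{\mathrm{MCM}}(R)$ is its stable category: the same objects, with morphisms $\mathrm{Hom}_R(M,N)$ modulo the maps that factor through a projective module. It is triangulated, with the cosyzygy $\Omega^{-1}$ as shift and with the distinguished triangles induced by the short exact sequences in $\mathrm{MCM}(R)$. Let $\underline{\mathrm{ann}}_R M$ be the annihilator of the $R$-module $\underline{\mathrm{End}}_R(M)$, and let $\mathrm{ca}(R)=\bigcap_{M\in\mathrm{MCM}(R)}\underline{\mathrm{ann}}_R M$. For a positive integer $n$, let $\mathfrak{CM}(n,R)$ be the set of isomorphism classes of objects of $\underline{\mathrm{MCM}}(R)$ with the coarsest topology in which every set $$\mathrm{cl}_n(M)=\{L : (\underline{\mathrm{ann}}_R L)^n\subseteq \underline{\mathrm{ann}}_R M\},\qquad M\in\mathrm{MCM}(R),$$ is closed. For a class $\mathcal I$ of objects of $\underline{\mathrm{MCM}}(R)$, let $\langle\mathcal I\rangle$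 be the smallest class that contains $\mathcal I$ and is closed under finite direct sums, direct summands and shifts. Put $\langle M\rangle_0=0$, $\langle M\rangle_1=\langle M\rangle$, and let $\langle M\rangle_{i+1}$ be $\langle\mathcal J\rangle$ for the class $\mathcal J$ of all $Y$ in a distinguished triangle $A\to Y\to B\to A[1]$ with $A\in\langle M\rangle_i$ and $B\in\langle M\rangle$. The generation time $g(M)$ is the least $g\ge 0$ with $\langle M\rangle_g=\underline{\mathrm{MCM}}(R)$ ($\infty$ if there is none). The Rouquier dimension $\dim\underline{\mathrm{MCM}}(R)$ is the least integer $d\ge 0$ such that $\langle M\rangle_{d+1}=\underline{\mathrm{MCM}}(R)$ for some $M$ ($\infty$ if there is none); thus, unless $\underline{\mathrm{MCM}}(R)=0$, $\dim\underline{\mathrm{MCM}}(R)+1=\min_M g(M)$. Then: 1. if $M$ is a maximal Cohen–Macaulay $R$-module with $g(M)<\infty$, then $(\underline{\mathrm{ann}}_R M)^{g(M)}\subseteq\mathrm{ca}(R)$; 2. the topological space $\mathfrak{CM}(n,R)$ is compact for every positive integer $n\ge\dim\underline{\mathrm{MCM}}(R)+1$, that is, for every positive integer $n$ such that $n\ge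 g(M)$ for some $M$. -/

import Mathlib

open CategoryTheory

universe u

noncomputable section

namespace StableMCM

variable (R : Type u) [CommRing R]

/-- `R` is (strongly) Gorenstein: the regular module has finite injective dimension. -/
def IsGorenstein : Prop :=
  ∃ n : ℕ, HasInjectiveDimensionLE (ModuleCat.of R R) n

section Depth

variable [IsLocalRing R]

open Classical in
/-- The depth of a module over a local ring: the supremum of the lengths of the regular sequences
on it in the maximal ideal, and `∞` for the zero module. -/
def depth (M : Type u) [AddCommGroup M] [Module R M] : ℕ∞ :=
  if Subsingleton M then ⊤
  else ⨆ (rs : List R) (_ : (∀ r ∈ rs, r ∈ IsLocalRing.maximalIdeal R) ∧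
    RingTheory.Sequence.IsRegular M rs), (rs.length : ℕ∞)

/-- Maximal Cohen-Macaulay modules: finitely generated, of depth at least the Krull dimension. -/
def isMCM : ObjectProperty (ModuleCat.{u} R) := fun M =>
  Module.Finite R M ∧ ringKrullDim R ≤ ((depth R M : ℕ∞) : WithBot ℕ∞)

/-- The category `MCM(R)`, a full subcategory of the category of `R`-modules. -/
abbrev MCM : Type (u + 1) := (isMCM R).FullSubcategory

variable {R}

/-- The homomorphism `f` factors through a (finitely generated) projective module. -/
def FactorsThroughProjective {M N : MCM R} (f : M ⟶ N) : Prop :=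
  ∃ (P : ModuleCat.{u} R) (a : M.obj ⟶ P) (b : P ⟶ N.obj),
    Module.Finite R P ∧ Module.Projective R P ∧ f.hom = a ≫ b

namespace FactorsThroughProjective

lemma zero (M N : MCM R) : FactorsThroughProjective (0 : M ⟶ N) :=
  ⟨ModuleCat.of R R, 0, 0, inferInstanceAs (Module.Finite R R),
    inferInstanceAs (Module.Projective R R), by simp⟩

lemma smul {M N : MCM R} {f : M ⟶ N} (hf : FactorsThroughProjective f) (r : R) :
    FactorsThroughProjective (r • f) := by
  obtain ⟨P, a, b, h1, h2, h⟩ := hf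
  refine ⟨P, r • a, b, h1, h2, ?_⟩
  change r • f.hom = _
  rw [h, Linear.smul_comp]

lemma neg {M N : MCM R} {f : M ⟶ N} (hf : FactorsThroughProjective f) :
    FactorsThroughProjective (-f) := by
  obtain ⟨P, a, b, h1, h2, h⟩ := hf
  refine ⟨P, -a, b, h1, h2, ?_⟩
  change -f.hom = _
  rw [h, Preadditive.neg_comp]

lemma add {M N : MCM R} {f g : M ⟶ N} (hf : FactorsThroughProjective f)
    (hg : FactorsThroughProjective g) : FactorsThroughProjective (f + g) := by
  obtain ⟨P, a, b, h1, h2, h⟩ := hf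
  obtain ⟨Q, c, d, h3, h4, h'⟩ := hg
  refine ⟨ModuleCat.of R (P × Q), ModuleCat.ofHom (a.hom.prod c.hom),
    ModuleCat.ofHom (b.hom.coprod d.hom), inferInstanceAs (Module.Finite R (P × Q)),
    inferInstanceAs (Module.Projective R (P × Q)), ?_⟩
  change f.hom + g.hom = _
  rw [h, h']
  ext x
  simp

lemma comp_left {L M N : MCM R} (e : L ⟶ M) {f : M ⟶ N} (hf : FactorsThroughProjective f) :
    FactorsThroughProjective (e ≫ f) := by
  obtain ⟨P, a, b, h1, h2, h⟩ := hf
  refine ⟨P, e.hom ≫ a, b, h1, h2, ?_⟩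
  change e.hom ≫ f.hom = _
  rw [h, Category.assoc]

lemma comp_right {M N L : MCM R} {f : M ⟶ N} (e : N ⟶ L) (hf : FactorsThroughProjective f) :
    FactorsThroughProjective (f ≫ e) := by
  obtain ⟨P, a, b, h1, h2, h⟩ := hf
  refine ⟨P, a, b ≫ e.hom, h1, h2, ?_⟩
  change f.hom ≫ e.hom = _
  rw [h, Category.assoc]

end FactorsThroughProjective

variable (R) in
/-- Two homomorphisms are stably equal if their difference factors through a projective module. -/
def stableRel : HomRel (MCM R) := fun _ _ f g => FactorsThroughProjective (f - g)

instance : Congruence (stableRel R) where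
  comp_left e f g h := by
    have := FactorsThroughProjective.comp_left e h
    rwa [Preadditive.comp_sub] at this
  comp_right e h := by
    have := FactorsThroughProjective.comp_right e h
    rwa [Preadditive.sub_comp] at this
  equivalence :=
    { refl := fun f => by
        change FactorsThroughProjective (f - f)
        rw [sub_self]
        exact .zero _ _
      symm := fun {f g} h => by
        have := FactorsThroughProjective.neg h
        rwa [neg_sub] at this
      trans := fun {f g k} h h' => by
        have := FactorsThroughProjective.add h h'
        rwa [sub_add_sub_cancel] at this }

variable (R)

/-- The stable category of maximal Cohen-Macaulay modules: the objects are those of `MCM(R)`, and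
the morphisms are `Hom_R(M, N) / P(M, N)`. -/
abbrev Stable : Type (u + 1) := Quotient (stableRel R)

/-- The quotient functor from `MCM(R)` to its stable category. -/
abbrev toStable : MCM R ⥤ Stable R := Quotient.functor (stableRel R)

lemma stableRel_add ⦃X Y : MCM R⦄ (f₁ f₂ g₁ g₂ : X ⟶ Y) (h : stableRel R f₁ f₂)
    (h' : stableRel R g₁ g₂) : stableRel R (f₁ + g₁) (f₂ + g₂) := by
  have := FactorsThroughProjective.add h h'
  rwa [sub_add_sub_comm] at this

lemma stableRel_smul (r : R) ⦃X Y : MCM R⦄ (f₁ f₂ : X ⟶ Y) (h : stableRel R f₁ f₂) :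
    stableRel R (r • f₁) (r • f₂) := by
  have := FactorsThroughProjective.smul h r
  rwa [smul_sub] at this

instance : Preadditive (Stable R) := Quotient.preadditive _ (stableRel_add R)

instance : (toStable R).Additive := Quotient.functor_additive _ (stableRel_add R)

instance : Linear R (Stable R) := Quotient.linear R _ (stableRel_smul R)

/-! ### Stable annihilators and the topological spaces -/

variable {R} in
/-- The stable annihilator of `M`: the annihilator of its stable endomorphism ring. -/
def sann (M : Stable R) : Ideal R := Module.annihilator R (M ⟶ M)

/-- The cohomology annihilator ideal of a Gorenstein local ring: the elements that stably
annihilate all maximal Cohen-Macaulay modules. -/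
def ca : Ideal R := ⨅ M : Stable R, sann M

lemma sann_le_of_iso {M N : Stable R} (e : M ≅ N) : sann M ≤ sann N := by
  intro r hr
  rw [sann, Module.mem_annihilator] at hr ⊢
  intro f
  have h := hr (e.hom ≫ f ≫ e.inv)
  have h2 : e.inv ≫ (r • (e.hom ≫ f ≫ e.inv)) ≫ e.hom = r • f := by simp
  rw [← h2, h]
  simp

/-- The isomorphism classes of objects of the stable category. -/
abbrev IsoClass : Type (u + 1) := _root_.Quotient (isIsomorphicSetoid (Stable R))

/-- The stable annihilator of an isomorphism class. -/
def IsoClass.sann : IsoClass R → Ideal R :=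
  _root_.Quotient.lift StableMCM.sann fun _ _ ⟨e⟩ =>
    le_antisymm (sann_le_of_iso R e) (sann_le_of_iso R e.symm)

/-- `cl_n(M)`: the classes of all `L` with `(sann L) ^ n ⊆ sann M`. -/
def cl (n : ℕ) (M : Stable R) : Set (IsoClass R) :=
  {L | IsoClass.sann R L ^ n ≤ sann M}

/-- The underlying set of the space of the `n`-th topology. -/
def CM (_n : ℕ) : Type (u + 1) := IsoClass R

/-- The topology whose closed sets are generated by the sets `cl_n(M)`: the coarsest topology in
which all of them are closed. -/
instance (n : ℕ) : TopologicalSpace (CM R n) :=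
  TopologicalSpace.generateFrom {U | ∃ M : Stable R, U = (cl R n M)ᶜ}

/-! ### Generation in the stable category

The stable category of a Gorenstein local ring is triangulated, with the cosyzygy as its shift, and
its distinguished triangles are, up to isomorphism, those given by the short exact sequences
of maximal Cohen-Macaulay modules. -/

variable {R} in
/-- `0 → A → B → C → 0` is a short exact sequence of modules. -/
def IsShortExact {A B C : MCM R} (f : A ⟶ B) (g : B ⟶ C) : Prop :=
  Function.Injective f.hom ∧ Function.Exact f.hom g.hom ∧ Function.Surjective g.hom

variable {R} in
/-- `N` is a syzygy of `M` (and `M` is a cosyzygy of `N`): there is a short exact sequence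
`0 → N → P → M → 0` with `P` projective. -/
def IsSyzygy (N M : MCM R) : Prop :=
  ∃ (P : MCM R) (f : N ⟶ P) (g : P ⟶ M), Module.Projective R P.obj ∧ IsShortExact f g

variable {R} in
/-- `⟨I⟩`: the smallest class of objects of the stable category that contains `I` and the zero
objects and is closed under finite direct sums, direct summands (in particular, isomorphism)
and shifts in both directions. -/
inductive closure (I : ObjectProperty (Stable R)) : ObjectProperty (Stable R)
  | of (X : Stable R) (hX : I X) : closure I X
  | zero (X : Stable R) (hX : Limits.IsZero X) : closure I X
  | sum (X Y : Stable R) (hX : closure I X) (hY : closure I Y)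
      (b : Limits.BinaryBicone X Y) (hb : b.IsBilimit) : closure I b.pt
  | summand (X Y : Stable R) (hY : closure I Y) (r : Retract X Y) : closure I X
  | syzygy (N M : MCM R) (h : IsSyzygy N M) (hM : closure I ((toStable R).obj M)) :
      closure I ((toStable R).obj N)
  | cosyzygy (N M : MCM R) (h : IsSyzygy N M) (hN : closure I ((toStable R).obj N)) :
      closure I ((toStable R).obj M)

variable {R} in
/-- `I * J`: the objects `Y` in a distinguished triangle `A → Y → B → A[1]` with `A` in `I` and
`B` in `J`. -/
def extensions (I J : ObjectProperty (Stable R)) : ObjectProperty (Stable R) := fun Y =>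
  ∃ (A B C : MCM R) (f : A ⟶ B) (g : B ⟶ C), IsShortExact f g ∧
    I.isoClosure ((toStable R).obj A) ∧ J.isoClosure ((toStable R).obj C) ∧
    Nonempty (Y ≅ (toStable R).obj B)

variable {R} in
/-- Rouquier's classes: `⟨M⟩_0` consists of the zero objects, `⟨M⟩_1 = ⟨M⟩`, and
`⟨M⟩_(i+1) = ⟨⟨M⟩_i * ⟨M⟩⟩`. -/
def level (M : Stable R) : ℕ → ObjectProperty (Stable R)
  | 0 => fun X => Limits.IsZero X
  | 1 => closure fun X => X = M
  | i + 2 => closure (extensions (level M (i + 1)) (closure fun X => X = M))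

variable {R} in
/-- The generation time of `M`: the least `g` for which `⟨M⟩_g` is the whole stable category
(`∞` if there is none). -/
def genTime (M : Stable R) : ℕ∞ :=
  ⨅ (g : ℕ) (_ : ∀ X, level M g X), (g : ℕ∞)

/-- Rouquier's dimension of the stable category: the least `d : ℕ` for which there is an `M`
such that `⟨M⟩_(d+1)` is the whole stable category (`∞` if there is none). -/
def rouquierDim : ℕ∞ :=
  ⨅ (d : ℕ) (_ : ∃ M : Stable R, ∀ X, level M (d + 1) X), (d : ℕ∞)

end Depth

end StableMCM

end

/-! An element lies in the stable annihilator of a module exactly when multiplication by it factors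
through a projective. Hence an ideal stably annihilating two modules also annihilates their direct
sum, and annihilators only grow under passage to summands. In a short exact sequence the
annihilators of the ends multiply into that of the middle (`IsShortExact.sann_mul_le`). A shift
changes nothing: one inclusion (`IsSyzygy.sann_le`) is formal, while the other (`IsSyzygy.sann_ge`)
extends maps into projectives along a syzygy sequence and needs `Ext¹(M, R) = 0`. So each level
costs one more factor of `sann M`, and once `⟨M⟩_g` is everything, `sann M ^ g` lies in `ca R`. For
compactness, if `sann M ^ n ≤ ca R`, then the class of `M` lies in every set `cl R n N`, so any
member of an open cover containing it is the whole space.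

The Gorenstein hypothesis enters only through `subsingleton_ext_one_of_isMCM`: the injective
dimension of `R` is at most `dim R`, hence at most the depth of `M`, and Nakayama along a regular
sequence kills the positive Ext groups. -/

namespace StableMCM

/-! ### Vanishing of Ext into a Gorenstein local ring -/

section ExtVanishing

open Abelian IsLocalRing RingTheory.Sequence

variable {R : Type u} [CommRing R]

/-- The long exact sequence: `Ext^i(X₁, N) = 0` and `Ext^i(X₃, N) = 0` imply `Ext^i(X₂, N) = 0`. -/
lemma subsingleton_ext_of_exact {S : ShortComplex (ModuleCat.{u} R)} (hS : S.ShortExact)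
    (N : ModuleCat.{u} R) (i : ℕ) (h₁ : Subsingleton (Ext S.X₁ N i))
    (h₃ : Subsingleton (Ext S.X₃ N i)) : Subsingleton (Ext S.X₂ N i) := by
  refine subsingleton_of_forall_eq 0 fun x => ?_
  obtain ⟨y, rfl⟩ := Ext.contravariant_sequence_exact₂ hS N x (Subsingleton.elim _ _)
  rw [Subsingleton.elim y 0, Ext.comp_zero]

/-- The long exact sequence: `Ext^i(X₂, N) = 0` and `Ext^(i+1)(X₃, N) = 0` imply
`Ext^i(X₁, N) = 0`. -/
lemma subsingleton_ext_left_of_exact {S : ShortComplex (ModuleCat.{u} R)} (hS : S.ShortExact)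
    (N : ModuleCat.{u} R) (i : ℕ) (h₂ : Subsingleton (Ext S.X₂ N i))
    (h₃ : Subsingleton (Ext S.X₃ N (i + 1))) : Subsingleton (Ext S.X₁ N i) := by
  refine subsingleton_of_forall_eq 0 fun x => ?_
  obtain ⟨y, rfl⟩ := Ext.contravariant_sequence_exact₁ hS N x (Nat.add_comm 1 i)
    (Subsingleton.elim _ _)
  rw [Subsingleton.elim y 0, Ext.comp_zero]

lemma subsingleton_ext_of_iso {X Y : ModuleCat.{u} R} (e : X ≅ Y) (N : ModuleCat.{u} R) (i : ℕ)
    (h : Subsingleton (Ext Y N i)) : Subsingleton (Ext X N i) := by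
  refine subsingleton_of_forall_eq 0 fun x => ?_
  have h1 : (Ext.mk₀ e.hom).comp ((Ext.mk₀ e.inv).comp x (zero_add i)) (zero_add i) = x := by
    rw [Ext.mk₀_comp_mk₀_assoc, e.hom_inv_id, Ext.mk₀_id_comp]
  rw [← h1, Subsingleton.elim ((Ext.mk₀ e.inv).comp x (zero_add i)) 0, Ext.comp_zero]

section LocalRing

variable [IsLocalRing R] [IsNoetherianRing R]

/-- The long exact sequence of `0 → M → M → M/xM → 0` makes `x` act surjectively on the finite
module `Ext^i(M, N)`, so Nakayama applies. -/
lemma subsingleton_ext_of_quotSMulTop (M : Type u) [AddCommGroup M] [Module R M]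
    [Module.Finite R M] (N : ModuleCat.{u} R) [Module.Finite R N] {x : R}
    (hx : x ∈ maximalIdeal R) (reg : IsSMulRegular M x) (i : ℕ)
    (h : Subsingleton (Ext (ModuleCat.of R (QuotSMulTop x M)) N (i + 1))) :
    Subsingleton (Ext (ModuleCat.of R M) N i) := by
  have hS := IsSMulRegular.smulShortComplex_shortExact (M := ModuleCat.of R M) reg
  by_contra! ntr
  have hmem : x ∈ (Module.annihilator R (Ext (ModuleCat.of R M) N i)).jacobson :=
    maximalIdeal_le_jacobson _ hx
  refine Submodule.top_ne_pointwise_smul_of_mem_jacobson_annihilator hmem ?_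
  rw [eq_comm, eq_top_iff]
  intro y _
  obtain ⟨z, hz⟩ := Ext.contravariant_sequence_exact₁ hS N y (Nat.add_comm 1 i)
    (@Subsingleton.elim _ h _ _)
  have hz' : x • (show Ext (ModuleCat.of R M) N i from z) = y := by
    have : (Ext.mk₀ (x • 𝟙 (ModuleCat.of R M))).comp (show Ext (ModuleCat.of R M) N i from z)
      (zero_add i) = y := hz
    rwa [Ext.mk₀_smul, Ext.smul_comp, Ext.mk₀_id_comp] at this
  rw [← hz']
  exact Submodule.smul_mem_pointwise_smul _ _ ⊤ trivial

/-- If `Ext^(n+1)(-, N)` vanishes on finite modules and `Ext^n(k, N) = 0`, then `Ext^n(-, N)`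
vanishes on finite modules. -/
lemma subsingleton_ext_of_residue (N : ModuleCat.{u} R) [Module.Finite R N] (n : ℕ)
    (h : ∀ (M : Type u) [AddCommGroup M] [Module R M] [Module.Finite R M],
      Subsingleton (Ext (ModuleCat.of R M) N (n + 1)))
    (hk : Subsingleton (Ext (ModuleCat.of R (R ⧸ maximalIdeal R)) N n))
    (M : Type u) [AddCommGroup M] [Module R M] [hM : Module.Finite R M] :
    Subsingleton (Ext (ModuleCat.of R M) N n) := by
  induction hM using IsNoetherianRing.induction_on_isQuotientEquivQuotientPrime R with
  | subsingleton L =>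
    have : Limits.IsZero (ModuleCat.of R L) := ModuleCat.isZero_of_subsingleton _
    refine subsingleton_of_forall_eq 0 fun x => ?_
    rw [← Ext.mk₀_id_comp x, this.eq_of_src (𝟙 (ModuleCat.of R L)) 0, Ext.mk₀_zero, Ext.zero_comp]
  | quotient L p e =>
    refine subsingleton_ext_of_iso e.toModuleIso N n ?_
    by_cases hp : p.1 = maximalIdeal R
    · rw [hp]
      exact hk
    · have hlt : ¬ maximalIdeal R ≤ p.1 := fun hle =>
        hp (le_antisymm (le_maximalIdeal p.2.ne_top) hle)
      obtain ⟨x, hx, hxp⟩ := SetLike.not_le_iff_exists.mp hlt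
      refine subsingleton_ext_of_quotSMulTop _ N hx ?_ n (h _)
      rw [isSMulRegular_iff_right_eq_zero_of_smul]
      intro y hy
      obtain ⟨y, rfl⟩ := Ideal.Quotient.mk_surjective y
      rw [Algebra.smul_def, Ideal.Quotient.algebraMap_eq, ← map_mul,
        Ideal.Quotient.eq_zero_iff_mem] at hy
      exact Ideal.Quotient.eq_zero_iff_mem.mpr ((p.2.mem_or_mem hy).resolve_left hxp)
  | exact L₁ L₂ L₃ f g hf hg hfg h₁ h₃ =>
    exact subsingleton_ext_of_exact (ModuleCat.shortComplex_shortExact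
      (ModuleCat.shortComplexOfCompEqZero f g hfg.linearMap_comp_eq_zero) hfg hf hg) N n h₁ h₃

/-- If `Ext^n(-, N)` does not vanish but `Ext^(n+1)(-, N)` does, on finite modules, then there are
`R`-regular sequences of all lengths at most `n`. -/
lemma exists_isRegular_of_ext_ne_zero (N : ModuleCat.{u} R) [Module.Finite R N] (n : ℕ)
    (h : ∀ (M : Type u) [AddCommGroup M] [Module R M] [Module.Finite R M],
      Subsingleton (Ext (ModuleCat.of R M) N (n + 1)))
    (hn : ¬ ∀ (M : Type u) [AddCommGroup M] [Module R M] [Module.Finite R M],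
      Subsingleton (Ext (ModuleCat.of R M) N n)) (j : ℕ) (hj : j ≤ n) :
    ∃ rs : List R, rs.length = j ∧ (∀ r ∈ rs, r ∈ maximalIdeal R) ∧ IsRegular R rs := by
  induction j with
  | zero => exact ⟨[], rfl, by simp, IsRegular.nil R R⟩
  | succ j ih =>
    obtain ⟨rs, hlen, hmem, hreg⟩ := ih (by lia)
    -- `L` has projective dimension `j < n`, so `Ext^n(L, N) = 0`. An embedding of the residue field
    -- into `L` would then force `Ext^n(k, N) = 0`, hence `Ext^n(-, N) = 0`. So the maximal ideal
    -- contains an `L`-regular element, which prolongs the sequence.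
    let L := R ⧸ (Ideal.ofList rs • (⊤ : Submodule R R))
    have hpd := ModuleCat.projectiveDimension_quotient_eq_add_length_of_isWeaklyRegular
      (ModuleCat.of R R) rs hreg.1 hmem
    rw [ModuleCat.projectiveDimension_eq_zero_of_projective (ModuleCat.of R R), zero_add,
      hlen] at hpd
    have hL : Subsingleton (Ext (ModuleCat.of R L) N n) := by
      have : HasProjectiveDimensionLE (ModuleCat.of R L) j :=
        (projectiveDimension_le_iff _ _).mp hpd.le
      exact HasProjectiveDimensionLT.subsingleton _ (j + 1) n hj N
    have hsub : Subsingleton ((R ⧸ maximalIdeal R) →ₗ[R] L) := by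
      by_contra! hntr
      obtain ⟨f, hf⟩ := exists_ne (0 : (R ⧸ maximalIdeal R) →ₗ[R] L)
      have : IsSimpleModule R (R ⧸ maximalIdeal R) :=
        isSimpleModule_iff_isCoatom.mpr (maximalIdeal.isMaximal R).out
      have hinj := (LinearMap.injective_or_eq_zero f).resolve_right hf
      refine hn fun M _ _ _ => subsingleton_ext_of_residue N n h ?_ M
      exact subsingleton_ext_left_of_exact (ModuleCat.shortComplex_shortExact
        (ModuleCat.shortComplexOfCompEqZero f f.range.mkQ
          f.exact_map_mkQ_range.linearMap_comp_eq_zero)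
        f.exact_map_mkQ_range hinj (Submodule.mkQ_surjective _)) N n hL (h _)
    obtain ⟨r, hr, hrL⟩ := IsSMulRegular.subsingleton_linearMap_iff.mp hsub
    rw [Ideal.annihilator_quotient] at hr
    have hmem' : ∀ a ∈ rs ++ [r], a ∈ maximalIdeal R := by
      intro a ha
      rcases List.mem_append.mp ha with ha | ha
      · exact hmem a ha
      · rwa [List.mem_singleton.mp ha]
    refine ⟨rs ++ [r], by simp [hlen], hmem', .of_isWeaklyRegular_of_mem_maximalIdeal R hmem' ?_⟩
    rw [isWeaklyRegular_append_iff]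
    exact ⟨hreg.1, (isWeaklyRegular_singleton_iff _ r).mpr hrL⟩

/-- By Nakayama, each regular element trades vanishing in degree `i + 1` for vanishing in degree
`i`. -/
lemma subsingleton_ext_of_isRegular (N : ModuleCat.{u} R) [Module.Finite R N] (n : ℕ)
    (h : ∀ i, n < i → ∀ (M : Type u) [AddCommGroup M] [Module R M] [Module.Finite R M],
      Subsingleton (Ext (ModuleCat.of R M) N i))
    (rs : List R) (hmem : ∀ r ∈ rs, r ∈ maximalIdeal R)
    (M : Type u) [AddCommGroup M] [Module R M] [Module.Finite R M] (hreg : IsWeaklyRegular M rs)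
    (i : ℕ) (hi : n < i + rs.length) : Subsingleton (Ext (ModuleCat.of R M) N i) := by
  induction rs generalizing M i with
  | nil => exact h i (by simpa using hi) M
  | cons x rs ih =>
    rw [isWeaklyRegular_cons_iff] at hreg
    rw [List.length_cons] at hi
    exact subsingleton_ext_of_quotSMulTop M N (hmem x (by simp)) hreg.1 i
      (ih (fun r hr => hmem r (by simp [hr])) _ hreg.2 (i + 1) (by lia))

/-- The injective dimension of a Gorenstein local ring is at most its Krull dimension. -/
lemma IsGorenstein.exists_ext_vanishing (hR : IsGorenstein R) :
    ∃ n : ℕ, (n : WithBot ℕ∞) ≤ ringKrullDim R ∧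
      ∀ i, n < i → ∀ (M : Type u) [AddCommGroup M] [Module R M] [Module.Finite R M],
        Subsingleton (Ext (ModuleCat.of R M) (ModuleCat.of R R) i) := by
  classical
  have hex : ∃ n : ℕ, ∀ i, n < i → ∀ (M : Type u) [AddCommGroup M] [Module R M]
      [Module.Finite R M], Subsingleton (Ext (ModuleCat.of R M) (ModuleCat.of R R) i) := by
    obtain ⟨n, hn⟩ := hR
    exact ⟨n, fun i hi M _ _ _ => HasInjectiveDimensionLT.subsingleton _ (n + 1) i hi _⟩
  refine ⟨Nat.find hex, ?_, Nat.find_spec hex⟩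
  rcases Nat.eq_zero_or_pos (Nat.find hex) with h0 | hpos
  · rw [h0]
    exact ringKrullDim_nonneg_of_nontrivial
  · obtain ⟨rs, hlen, -, hreg⟩ := exists_isRegular_of_ext_ne_zero (ModuleCat.of R R)
      (Nat.find hex) (fun M _ _ _ => Nat.find_spec hex _ (by lia) M)
      (fun hv => Nat.find_min hex (m := Nat.find hex - 1) (by lia) fun i hi M _ _ _ => by
        rcases (show Nat.find hex ≤ i by lia).eq_or_lt with rfl | hi'
        · exact hv M
        · exact Nat.find_spec hex i hi' M) _ le_rfl
    -- A regular sequence whose length is the minimal bound lowers the dimension of `R` by that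
    -- much.
    rw [← ringKrullDim_add_length_eq_ringKrullDim_of_isRegular rs hreg, hlen]
    have : Nontrivial (R ⧸ Ideal.ofList rs) := Ideal.Quotient.nontrivial_iff.mpr fun htop =>
      hreg.2 (by rw [htop, Submodule.top_smul])
    exact le_add_of_nonneg_left ringKrullDim_nonneg_of_nontrivial

/-- Maximal Cohen-Macaulay modules over a Gorenstein local ring have no extensions by the ring. -/
lemma subsingleton_ext_one_of_isMCM (hR : IsGorenstein R) (M : MCM R) :
    Subsingleton (Ext M.obj (ModuleCat.of R R) 1) := by
  obtain ⟨n, hn, hext⟩ := hR.exists_ext_vanishing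
  obtain ⟨hfin, hdepth⟩ := M.property
  have hle : (n : ℕ∞) ≤ depth R M.obj := by
    have := hn.trans hdepth
    exact_mod_cast this
  -- Weak regularity suffices for the Nakayama descent and lets the zero module, of depth `∞`, be
  -- treated by a sequence of zeros.
  have hreg : ∃ rs : List R, (∀ r ∈ rs, r ∈ maximalIdeal R) ∧ IsWeaklyRegular M.obj rs ∧
      n ≤ rs.length := by
    rw [depth] at hle
    split_ifs at hle with hsub
    · refine ⟨List.replicate n 0, by simp +contextual [List.mem_replicate], ?_, by simp⟩
      refine ⟨fun i hi => ?_⟩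
      exact fun x y _ => Subsingleton.elim x y
    · by_contra! hlt
      rcases Nat.eq_zero_or_pos n with rfl | hpos
      · exact absurd (hlt [] (by simp) (.nil R _)) (by simp)
      -- If all regular sequences were shorter than `n`, their supremum would be at most `n - 1`.
      · have : (n : ℕ∞) ≤ (n - 1 : ℕ) := hle.trans <| iSup₂_le fun rs hrs => by
          have := hlt rs hrs.1 hrs.2.1
          exact_mod_cast (by lia : rs.length ≤ n - 1)
        have : n ≤ n - 1 := by exact_mod_cast this
        lia
  obtain ⟨rs, hmem, hreg, hlen⟩ := hreg
  exact subsingleton_ext_of_isRegular _ n hext rs hmem M.obj hreg 1 (by lia)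

end LocalRing

/-- If `Ext¹(M, R) = 0` then maps into finite projective modules extend along a monomorphism with
cokernel `M`. -/
lemma exists_extension_of_ext_one {A B M Q : ModuleCat.{u} R} (f : A ⟶ B) (g : B ⟶ M)
    (hf : Function.Injective f.hom) (hfg : Function.Exact f.hom g.hom)
    (hg : Function.Surjective g.hom) (h : Subsingleton (Ext M (ModuleCat.of R R) 1))
    [Module.Finite R Q] [Module.Projective R Q] (a : A ⟶ Q) : ∃ b : B ⟶ Q, f ≫ b = a := by
  have hS := ModuleCat.shortComplex_shortExact
    (ModuleCat.shortComplexOfCompEqZero f.hom g.hom hfg.linearMap_comp_eq_zero) hfg hf hg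
  have key (φ : A ⟶ ModuleCat.of R R) : ∃ ψ : B ⟶ ModuleCat.of R R, f ≫ ψ = φ := by
    obtain ⟨ψ, hψ⟩ := Ext.contravariant_sequence_exact₁ hS _ (Ext.mk₀ φ) (Nat.add_comm 1 0)
      (@Subsingleton.elim _ h _ _)
    obtain ⟨ψ, rfl⟩ := Ext.homEquiv₀.symm.surjective ψ
    exact ⟨ψ, Ext.homEquiv₀.symm.injective (by simpa using hψ)⟩
  -- `Q` is a direct summand of `R^n`, so it suffices to extend the coordinates of `s ∘ a` and
  -- project back by `p`.
  obtain ⟨n, p, hp⟩ := Module.Finite.exists_fin' R Q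
  obtain ⟨s, hs⟩ := Module.projective_lifting_property p LinearMap.id hp
  choose ψ hψ using fun i : Fin n => key (ModuleCat.ofHom (LinearMap.proj i ∘ₗ s ∘ₗ a.hom))
  refine ⟨ModuleCat.ofHom (p ∘ₗ LinearMap.pi fun i => (ψ i).hom), ?_⟩
  ext x
  have h1 : (LinearMap.pi fun i => (ψ i).hom) (f.hom x) = s (a.hom x) := by
    funext i
    exact congrArg (fun k => k.hom x) (hψ i)
  change p ((LinearMap.pi fun i => (ψ i).hom) (f.hom x)) = a.hom x
  rw [h1]
  exact LinearMap.congr_fun hs (a.hom x)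

end ExtVanishing

/-! ### Stable annihilators and exact sequences -/

section StableAnnihilators

variable {R : Type u} [CommRing R] [IsLocalRing R]

lemma mem_sann_iff_smul_id {X : Stable R} {r : R} : r ∈ sann X ↔ r • 𝟙 X = 0 := by
  rw [sann, Module.mem_annihilator]
  refine ⟨fun h => h _, fun h f => ?_⟩
  rw [← Category.id_comp f, ← Linear.smul_comp, h, Limits.zero_comp]

lemma toStable_map_eq_zero_iff {M N : MCM R} (f : M ⟶ N) :
    (toStable R).map f = 0 ↔ FactorsThroughProjective f := by
  rw [← (toStable R).map_zero M N, Quotient.functor_map_eq_iff]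
  change FactorsThroughProjective (f - 0) ↔ _
  rw [sub_zero]

lemma mem_sann_toStable_iff {M : MCM R} {r : R} :
    r ∈ sann ((toStable R).obj M) ↔ FactorsThroughProjective (r • 𝟙 M) := by
  rw [mem_sann_iff_smul_id, ← toStable_map_eq_zero_iff]
  exact Iff.rfl

lemma sann_eq_top_of_isZero {X : Stable R} (hX : Limits.IsZero X) : sann X = ⊤ := by
  rw [Ideal.eq_top_iff_one, mem_sann_iff_smul_id]
  exact hX.eq_of_src _ _

lemma sann_le_of_retract {X Y : Stable R} (h : Retract X Y) : sann Y ≤ sann X := by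
  intro r hr
  rw [mem_sann_iff_smul_id] at hr ⊢
  rw [← h.retract, ← Category.id_comp h.r, ← Linear.comp_smul, ← Linear.smul_comp, hr,
    Limits.zero_comp, Limits.comp_zero]

lemma sann_inf_le_of_isBilimit {X Y : Stable R} (b : Limits.BinaryBicone X Y)
    (hb : b.IsBilimit) : sann X ⊓ sann Y ≤ sann b.pt := by
  intro r hr
  obtain ⟨hX, hY⟩ := Submodule.mem_inf.mp hr
  rw [mem_sann_iff_smul_id] at hX hY ⊢
  refine Limits.BinaryCofan.IsColimit.hom_ext hb.isColimit ?_ ?_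
  · change b.inl ≫ (r • 𝟙 b.pt) = b.inl ≫ 0
    rw [Linear.comp_smul, Category.comp_id, Limits.comp_zero, ← Category.id_comp b.inl,
      ← Linear.smul_comp, hX, Limits.zero_comp]
  · change b.inr ≫ (r • 𝟙 b.pt) = b.inr ≫ 0
    rw [Linear.comp_smul, Category.comp_id, Limits.comp_zero, ← Category.id_comp b.inr,
      ← Linear.smul_comp, hY, Limits.zero_comp]

/-- A stably trivial map lifts along surjections of maximal Cohen-Macaulay modules, and the lift
can be chosen stably trivial. -/
lemma FactorsThroughProjective.exists_lift {L B C : MCM R} {a : L ⟶ C}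
    (ha : FactorsThroughProjective a) (g : B ⟶ C) (hg : Function.Surjective g.hom) :
    ∃ h : L ⟶ B, FactorsThroughProjective h ∧ h ≫ g = a := by
  obtain ⟨P, i, p, h1, h2, hip⟩ := ha
  obtain ⟨q, hq⟩ := Module.projective_lifting_property g.hom.hom p.hom hg
  refine ⟨⟨i ≫ ModuleCat.ofHom q⟩, ⟨P, i, ModuleCat.ofHom q, h1, h2, rfl⟩, ?_⟩
  refine ObjectProperty.hom_ext _ ?_
  change (i ≫ ModuleCat.ofHom q) ≫ g.hom = a.hom
  have : ModuleCat.ofHom q ≫ g.hom = p := ModuleCat.hom_ext hq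
  rw [Category.assoc, this, hip]

/-- Maps killed by `g` factor through the kernel of `g`. -/
lemma IsShortExact.exists_lift {A B C L : MCM R} {f : A ⟶ B} {g : B ⟶ C} (h : IsShortExact f g)
    (k : L ⟶ B) (hk : k ≫ g = 0) : ∃ t : L ⟶ A, t ≫ f = k := by
  obtain ⟨hf, hfg, -⟩ := h
  have hr (x : L.obj) : k.hom x ∈ LinearMap.range f.hom.hom := by
    refine (hfg (k.hom x)).mp ?_
    exact congrArg (fun m : L ⟶ C => m.hom.hom x) hk
  let e := LinearEquiv.ofInjective f.hom.hom hf
  refine ⟨⟨ModuleCat.ofHom (e.symm.toLinearMap ∘ₗ k.hom.hom.codRestrict _ hr)⟩, ?_⟩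
  refine ObjectProperty.hom_ext _ (ModuleCat.hom_ext (LinearMap.ext fun x => ?_))
  exact congrArg Subtype.val (e.apply_symm_apply ⟨k.hom x, hr x⟩)

lemma IsShortExact.cancel_mono {A B C L : MCM R} {f : A ⟶ B} {g : B ⟶ C} (h : IsShortExact f g)
    {k l : L ⟶ A} (hkl : k ≫ f = l ≫ f) : k = l := by
  refine ObjectProperty.hom_ext _ (ModuleCat.hom_ext (LinearMap.ext fun x => h.1 ?_))
  exact congrArg (fun m : L ⟶ B => m.hom.hom x) hkl

lemma IsShortExact.comp_eq_zero {A B C : MCM R} {f : A ⟶ B} {g : B ⟶ C} (h : IsShortExact f g) :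
    f ≫ g = 0 := by
  refine ObjectProperty.hom_ext _ (ModuleCat.hom_ext (LinearMap.ext fun x => ?_))
  exact h.2.1.apply_apply_eq_zero x

/-- Maps that kill `f` factor through the cokernel of `f`. -/
lemma IsShortExact.exists_desc {A B C L : MCM R} {f : A ⟶ B} {g : B ⟶ C} (h : IsShortExact f g)
    (k : B ⟶ L) (hk : f ≫ k = 0) : ∃ t : C ⟶ L, g ≫ t = k := by
  obtain ⟨-, hfg, hg⟩ := h
  have hker : LinearMap.ker g.hom.hom ≤ LinearMap.ker k.hom.hom := by
    intro x hx
    obtain ⟨y, rfl⟩ := (hfg x).mp hx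
    exact congrArg (fun m : A ⟶ L => m.hom.hom y) hk
  let e := LinearMap.quotKerEquivOfSurjective g.hom.hom hg
  refine ⟨⟨ModuleCat.ofHom ((LinearMap.ker g.hom.hom).liftQ k.hom.hom hker ∘ₗ
    e.symm.toLinearMap)⟩, ?_⟩
  refine ObjectProperty.hom_ext _ (ModuleCat.hom_ext (LinearMap.ext fun x => ?_))
  have he : e.symm (g.hom.hom x) = Submodule.Quotient.mk x := by
    rw [LinearEquiv.symm_apply_eq]
    rfl
  change (LinearMap.ker g.hom.hom).liftQ k.hom.hom hker (e.symm (g.hom.hom x)) = k.hom.hom x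
  rw [he]
  exact Submodule.liftQ_apply _ _ _

lemma IsShortExact.cancel_epi {A B C L : MCM R} {f : A ⟶ B} {g : B ⟶ C} (h : IsShortExact f g)
    {k l : C ⟶ L} (hkl : g ≫ k = g ≫ l) : k = l := by
  refine ObjectProperty.hom_ext _ (ModuleCat.hom_ext (LinearMap.ext fun x => ?_))
  obtain ⟨y, rfl⟩ := h.2.2 x
  exact congrArg (fun m : B ⟶ L => m.hom.hom y) hkl

/-- Stable annihilators multiply along short exact sequences. -/
lemma IsShortExact.sann_mul_le {A B C : MCM R} {f : A ⟶ B} {g : B ⟶ C} (h : IsShortExact f g) :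
    sann ((toStable R).obj A) * sann ((toStable R).obj C) ≤ sann ((toStable R).obj B) := by
  rw [Ideal.mul_le]
  intro s hs r hr
  rw [mem_sann_toStable_iff] at hs hr ⊢
  obtain ⟨l, hl, hlg⟩ := hr.exists_lift g h.2.2
  obtain ⟨t, ht⟩ := h.exists_lift (r • 𝟙 B - g ≫ l) (by
    rw [Preadditive.sub_comp, Category.assoc, hlg, Linear.smul_comp, Linear.comp_smul,
      Category.id_comp, Category.comp_id, sub_self])
  -- On `B`, `r` is the stably trivial `g ≫ l` plus a map through `A`; the factor `s` makes the
  -- latter stably trivial too.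
  have heq : (s * r) • 𝟙 B = s • (g ≫ l) + t ≫ (s • 𝟙 A) ≫ f := by
    rw [Linear.smul_comp, Category.id_comp, Linear.comp_smul, ht, mul_smul, smul_sub]
    abel
  rw [heq]
  exact ((hl.comp_left g).smul s).add ((hs.comp_right f).comp_left t)

/-- A syzygy has at least the stable annihilator of the module. -/
lemma IsSyzygy.sann_le {N M : MCM R} (h : IsSyzygy N M) :
    sann ((toStable R).obj M) ≤ sann ((toStable R).obj N) := by
  obtain ⟨P, f, g, hP, hfg⟩ := h
  intro r hr
  rw [mem_sann_toStable_iff] at hr ⊢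
  obtain ⟨l, -, hlg⟩ := hr.exists_lift g hfg.2.2
  -- Here `f ≫ g = 0` gives `f ≫ t = r • 𝟙 N`, a factorization through `P`.
  obtain ⟨t, ht⟩ := hfg.exists_lift (r • 𝟙 P - g ≫ l) (by
    rw [Preadditive.sub_comp, Category.assoc, hlg, Linear.smul_comp, Linear.comp_smul,
      Category.id_comp, Category.comp_id, sub_self])
  refine ⟨P.obj, f.hom, t.hom, P.property.1, hP, ?_⟩
  have heq : f ≫ t = r • 𝟙 N := hfg.cancel_mono (by
    rw [Category.assoc, ht, Preadditive.comp_sub, ← Category.assoc, hfg.comp_eq_zero,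
      Limits.zero_comp, sub_zero, Linear.comp_smul, Linear.smul_comp, Category.id_comp,
      Category.comp_id])
  rw [← heq]
  rfl

lemma mul_le_sann_of_extensions {I J : ObjectProperty (Stable R)} {a b : Ideal R}
    (ha : ∀ X, I X → a ≤ sann X) (hb : ∀ X, J X → b ≤ sann X) {X : Stable R}
    (hX : extensions I J X) : a * b ≤ sann X := by
  obtain ⟨A, B, C, f, g, h, ⟨X', hX', ⟨e⟩⟩, ⟨Y', hY', ⟨e'⟩⟩, ⟨e''⟩⟩ := hX
  have hA := (ha X' hX').trans (sann_le_of_iso R e.symm)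
  have hC := (hb Y' hY').trans (sann_le_of_iso R e'.symm)
  exact (Ideal.mul_mono hA hC).trans (h.sann_mul_le.trans (sann_le_of_iso R e''.symm))

/-! ### Attained infima and compactness -/

lemma forall_level_of_genTime_eq {M : Stable R} {g : ℕ} (h : genTime M = g) :
    ∀ X, level M g X := by
  -- A strict upper bound on the infimum yields an actual level `k` with `g ≤ k < g + 1`.
  have hlt : genTime M < (g + 1 : ℕ) := by
    rw [h]
    exact_mod_cast g.lt_succ_self
  obtain ⟨k, hk, hkg⟩ := (by simpa only [genTime, iInf_lt_iff] using hlt :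
    ∃ (k : ℕ) (_ : ∀ X, level M k X), (k : ℕ∞) < (g + 1 : ℕ))
  have hle : (g : ℕ∞) ≤ k := h ▸ iInf₂_le k hk
  have h1 : g ≤ k := by exact_mod_cast hle
  have h2 : k < g + 1 := by exact_mod_cast hkg
  rwa [show g = k by lia]

lemma exists_forall_level_of_rouquierDim_lt {n : ℕ} (h : rouquierDim R + 1 ≤ (n : ℕ∞)) :
    ∃ (M : Stable R) (g : ℕ), g ≤ n ∧ ∀ X, level M g X := by
  have hlt : rouquierDim R < n :=
    (ENat.add_one_le_iff fun htop => by simp [htop] at h).mp h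
  obtain ⟨d, ⟨M, hM⟩, hd⟩ := (by simpa only [rouquierDim, iInf_lt_iff] using hlt :
    ∃ (d : ℕ) (_ : ∃ M : Stable R, ∀ X, level M (d + 1) X), (d : ℕ∞) < n)
  exact ⟨M, d + 1, Nat.succ_le_of_lt (by exact_mod_cast hd), hM⟩

/-- If the `n`-th power of the stable annihilator of `M` lies in `ca(R)`, then the
`n`-th topology is compact: the class of `M` has no open neighbourhood but the whole space. -/
lemma compactSpace_CM_of_pow_le_ca (n : ℕ) (M : Stable R) (h : sann M ^ n ≤ ca R) :
    CompactSpace (CM R n) := by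
  let x : CM R n := Quotient.mk (isIsomorphicSetoid (Stable R)) M
  have huniv (U : Set (CM R n)) (hU : IsOpen U) : x ∈ U → U = Set.univ := by
    induction hU with
    | basic U hU =>
      obtain ⟨N, rfl⟩ := hU
      -- The class of `M` lies in every `cl R n N`, so it is in no subbasic open set.
      exact fun hx => absurd (h.trans (iInf_le _ N)) hx
    | univ => exact fun _ => rfl
    | inter U V _ _ ihU ihV => exact fun hx => by rw [ihU hx.1, ihV hx.2, Set.univ_inter]
    | sUnion S _ ih =>
      rintro ⟨U, hU, hx⟩
      exact Set.eq_univ_of_univ_subset (ih U hU hx ▸ Set.subset_sUnion_of_mem hU)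
  refine ⟨isCompact_of_finite_subcover fun U hU hcover => ?_⟩
  obtain ⟨i, hi⟩ := Set.mem_iUnion.mp (hcover (Set.mem_univ x))
  exact ⟨{i}, by simp [huniv _ (hU i) hi]⟩

/-! ### Annihilators along Rouquier's levels -/

variable [IsNoetherianRing R]

/-- Over a Gorenstein ring, a module has at least the stable annihilator of its syzygy. -/
lemma IsSyzygy.sann_ge (hR : IsGorenstein R) {N M : MCM R} (h : IsSyzygy N M) :
    sann ((toStable R).obj N) ≤ sann ((toStable R).obj M) := by
  obtain ⟨P, f, g, hP, hfg⟩ := h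
  intro r hr
  rw [mem_sann_toStable_iff] at hr ⊢
  obtain ⟨Q, a, b, h1, h2, hab⟩ := hr
  -- As `Ext¹(M, R) = 0`, `a` extends from `N` to `P`. Then `r • 𝟙 P - t ≫ f` kills `N` and descends
  -- to `l : M ⟶ P` with `l ≫ g = r • 𝟙 M`.
  obtain ⟨c, hc⟩ := exists_extension_of_ext_one f.hom g.hom hfg.1 hfg.2.1 hfg.2.2
    (subsingleton_ext_one_of_isMCM hR M) a
  let t : P ⟶ N := ⟨c ≫ b⟩
  have ht : f ≫ t = r • 𝟙 N := by
    refine ObjectProperty.hom_ext _ ?_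
    change f.hom ≫ c ≫ b = _
    rw [hab, ← Category.assoc, hc]
  obtain ⟨l, hl⟩ := hfg.exists_desc (r • 𝟙 P - t ≫ f) (by
    rw [Preadditive.comp_sub, ← Category.assoc, ht, Linear.smul_comp, Linear.comp_smul,
      Category.id_comp, Category.comp_id, sub_self])
  refine ⟨P.obj, l.hom, g.hom, P.property.1, hP, ?_⟩
  have heq : l ≫ g = r • 𝟙 M := hfg.cancel_epi (by
    rw [← Category.assoc, hl, Preadditive.sub_comp, Category.assoc, hfg.comp_eq_zero,
      Limits.comp_zero, sub_zero, Linear.comp_smul, Linear.smul_comp, Category.id_comp,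
      Category.comp_id])
  rw [← heq]
  rfl

/-- An ideal that stably annihilates a class of modules stably annihilates its closure. -/
lemma le_sann_of_closure (hR : IsGorenstein R) {I : ObjectProperty (Stable R)} {J : Ideal R}
    (hJ : ∀ X, I X → J ≤ sann X) {X : Stable R} (hX : closure I X) : J ≤ sann X := by
  induction hX with
  | of X hX => exact hJ X hX
  | zero X hX => exact (sann_eq_top_of_isZero hX).symm ▸ le_top
  | sum X Y _ _ b hb ihX ihY => exact (le_inf ihX ihY).trans (sann_inf_le_of_isBilimit b hb)
  | summand X Y _ r ih => exact ih.trans (sann_le_of_retract r)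
  | syzygy N M h _ ih => exact ih.trans h.sann_le
  | cosyzygy N M h _ ih => exact ih.trans (h.sann_ge hR)

/-- The `i`-th power of the stable annihilator of `M` stably annihilates `⟨M⟩_i`. -/
lemma sann_pow_le_of_level (hR : IsGorenstein R) (M : Stable R) (i : ℕ) {X : Stable R}
    (hX : level M i X) : sann M ^ i ≤ sann X := by
  have hM {X : Stable R} (hX : closure (fun X => X = M) X) : sann M ≤ sann X :=
    le_sann_of_closure hR (fun _ h => h ▸ le_rfl) hX
  induction i using Nat.twoStepInduction generalizing X with
  | zero => exact (sann_eq_top_of_isZero hX).symm ▸ le_top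
  | one => exact (pow_one (sann M)).symm ▸ hM hX
  | more i _ ih =>
    rw [pow_succ]
    exact le_sann_of_closure hR (fun Y hY =>
      mul_le_sann_of_extensions (fun _ h => ih h) (fun _ h => hM h) hY) hX

lemma sann_pow_le_ca (hR : IsGorenstein R) (M : Stable R) (g : ℕ) (hg : ∀ X, level M g X) :
    sann M ^ g ≤ ca R :=
  le_iInf fun X => sann_pow_le_of_level hR M g (hg X)

end StableAnnihilators

end StableMCM

theorem corollary4p9 {R : Type u} [CommRing R] [IsNoetherianRing R] [IsLocalRing R]
    (hR : StableMCM.IsGorenstein R) :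
    (∀ (M : StableMCM.Stable R) (g : ℕ), StableMCM.genTime M = (g : ℕ∞) →
      StableMCM.sann M ^ g ≤ StableMCM.ca R) ∧
    ∀ n : ℕ, 0 < n → StableMCM.rouquierDim R + 1 ≤ (n : ℕ∞) →
      CompactSpace (StableMCM.CM R n) := by
  refine ⟨fun M g hg => StableMCM.sann_pow_le_ca hR M g (StableMCM.forall_level_of_genTime_eq hg),
    fun n _ hn => ?_⟩
  obtain ⟨M, g, hgn, hg⟩ := StableMCM.exists_forall_level_of_rouquierDim_lt hn
  -- Passing from `g` to `n ≥ g` uses that powers of an ideal decrease; no monotonicity of the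
  -- levels is needed.
  exact StableMCM.compactSpace_CM_of_pow_le_ca n M
    ((Ideal.pow_le_pow_right hgn).trans (StableMCM.sann_pow_le_ca hR M g hg))
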